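/- Let $\gamma_{\mathrm{TF}}:=(3\pi^2)^{2/3}/2$. For $Z>0$ consider the Thomas–Fermi functional $$\mathcal E_{\mathrm{TF}}(\rho):=\int_{\mathbb R^3}\Big[\tfrac35\gamma_{\mathrm{TF}}\,\rho(x)^{5/3}-\frac{Z}{|x|}\rho(x)\Big]dx+\frac12\int_{\mathbb R^3}\int_{\mathbb R^3}\frac{\rho(x)\rho(y)}{|x-y|}\,dx\,dy$$ on the nonnegative functions $\rho\in L^1(\mathbb R^3)\cap L^{5/3}(\mathbb R^3)$, and let $\rho_{\mathrm{TF}}$ (depending on $Z$) denote its minimizer. For a density $\sigma$ and $x\in\mathbb R^3$ let $R_\sigma(x)$ be the smallest radius $R\ge 0$ with $\int_{|x-y|<R}\sigma(y)\,dy=\frac12$, and let $$L_\sigma(x):=\int_{|x-y|<R_\sigma(x)}\frac{\sigma(y)}{|x-y|}\,dy$$ be the potential of the exchange hole of $\sigma$ at $x$. Then $\|L_{\rho_{\mathrm{TF}}}\|_\infty=O(Z)$. That is, there is a constant $C$ such that for every real $Z>\frac12$ and every $x\in\mathbb R^3$ the radius $R_{\rho_{\mathrm{TF}}}(x)$ exists,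 the integral defining $L_{\rho_{\mathrm{TF}}}(x)$ converges absolutely, and $|L_{\rho_{\mathrm{TF}}}(x)|\le C\,Z$. -/

import Mathlib

open MeasureTheory

namespace ThomasFermi

/-- Physical space `ℝ³` with the Euclidean norm and Lebesgue measure. -/
abbrev Space : Type := EuclideanSpace ℝ (Fin 3)

/-- The Thomas-Fermi constant `(3π²)^(2/3) / 2` (two spin states, atomic units). -/
noncomputable def gammaTF : ℝ := (3 * Real.pi ^ 2) ^ (2 / 3 : ℝ) / 2

/-- The Coulomb scalar product `D(ρ, σ) = (1/2) ∬ ρ(x) σ(y) / |x - y| dx dy`. On admissible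
densities the double integral converges absolutely. -/
noncomputable def coulomb (ρ σ : Space → ℝ) : ℝ :=
  (1 / 2) * ∫ x : Space, ∫ y : Space, ρ x * σ y / ‖x - y‖

/-- The Thomas-Fermi functional of an atom with nuclear charge `Z`. On admissible densities
all integrals converge absolutely. -/
noncomputable def energy (Z : ℝ) (ρ : Space → ℝ) : ℝ :=
  (∫ x : Space, ((3 / 5) * gammaTF * ρ x ^ (5 / 3 : ℝ) - Z / ‖x‖ * ρ x)) + coulomb ρ ρ

/-- Admissible densities: nonnegative functions in `L¹(ℝ³) ∩ L^(5/3)(ℝ³)`. -/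
structure Admissible (ρ : Space → ℝ) : Prop where
  nonneg : ∀ᵐ x ∂(volume : Measure Space), 0 ≤ ρ x
  memLp_one : MemLp ρ 1 volume
  memLp_five_thirds : MemLp ρ (5 / 3) volume

/-- `ρ` is (a representative of) the Thomas-Fermi density of charge `Z`: it minimizes the
Thomas-Fermi functional over all admissible densities. -/
def IsTFDensity (Z : ℝ) (ρ : Space → ℝ) : Prop :=
  Admissible ρ ∧ ∀ σ : Space → ℝ, Admissible σ → energy Z ρ ≤ energy Z σ

/-- The radii `R ≥ 0` such that the ball of radius `R` about `x` carries charge `1/2`. -/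
def halfChargeRadii (σ : Space → ℝ) (x : Space) : Set ℝ :=
  {R : ℝ | 0 ≤ R ∧ ∫ y in Metric.ball x R, σ y = 1 / 2}

/-- The radius of the exchange hole of `σ` at `x`: the smallest radius of a ball about `x`
that carries charge `1/2` (meaningful when there is such a smallest radius). -/
noncomputable def holeRadius (σ : Space → ℝ) (x : Space) : ℝ :=
  sInf (halfChargeRadii σ x)

/-- The potential of the exchange hole of `σ`, evaluated at its center `x`. -/
noncomputable def holePotential (σ : Space → ℝ) (x : Space) : ℝ :=
  ∫ y in Metric.ball x (holeRadius σ x), σ y / ‖x - y‖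

end ThomasFermi

/-! The bound rests on two consequences of minimality, both obtained by inserting a trial density
into the functional.

* `IsTFDensity.ae_le`: `ρ(x) ≤ (Z / (γ|x|))^(3/2)` almost everywhere. The right-hand side minimizes
  the local energy `(3/5) γ t^(5/3) - (Z/|x|) t` over `t ≥ 0`. Cutting `ρ` off at this value
  does not increase the Coulomb repulsion, and it strictly lowers the local energy if anything
  is cut off.
* `IsTFDensity.le_charge`: `Z ≤ ∫ ρ`. Adding a small multiple of the indicator of the ball of
  radius `R` about the nucleus changes the energy to first order by at most
  `O(R) + (∫ ρ - Z) W`, where `W = ∫_{|y|<R} dy/|y|` is at least of order `R²`. Here the potential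
  of the ball is largest at its center, so that the repulsion of `ρ` is at most `(∫ ρ) W`. If
  `∫ ρ < Z`, the change would be negative for large `R`.

Since `∫ ρ ≥ Z > 1/2` and the charge of a ball is continuous in its radius, a smallest radius of
charge `1/2` exists. The hole is then split at distance `1/Z` from its center: the outer part
contributes at most `Z · (1/2)`, and in the inner part the pointwise bound on `ρ` leaves
`(Z/γ)^(3/2) ∫_{|x-y|<1/Z} |y|^(-3/2) |x-y|^(-1) dy`, which is at most a constant times
`Z^(3/2) Z^(-1/2) = Z` uniformly in `x`.

Absolute convergence of all Coulomb integrals comes from the elementary inequality `div_norm_le`,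
which dominates `ρ(y)/|x-y|` by `ρ + ρ^(5/3)` plus the kernel `|x-y|^(-5/2)` cut off at distance
`1`, which is integrable in dimension three. -/

open MeasureTheory

namespace ThomasFermi

/-! ### The kernel `|x|^(-5/2)` and inequalities for powers -/

theorem gammaTF_pos : 0 < gammaTF := by
  unfold gammaTF; positivity

theorem integrableOn_norm_rpow_ball (s : ℝ) :
    IntegrableOn (fun y : Space => ‖y‖ ^ (-(5 / 2) : ℝ)) (Metric.ball 0 s) := by
  have h := (integrableOn_fun_norm_addHaar (volume : Measure Space)
    (f := fun r => r ^ (-(5 / 2) : ℝ)) (r := s)).2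
  apply h
  have h2 : IntegrableOn (fun r : ℝ => r ^ (-(1 / 2) : ℝ)) (Set.Ioo 0 s) := by
    rcases le_or_gt s 0 with hs | hs
    · simp [Set.Ioo_eq_empty (not_lt.2 hs)]
    · exact (intervalIntegral.integrableOn_Ioo_rpow_iff hs).2 (by norm_num)
  refine h2.congr_fun (fun r hr => ?_) measurableSet_Ioo
  simp only [finrank_euclideanSpace, Fintype.card_fin, smul_eq_mul]
  rw [← Real.rpow_natCast, ← Real.rpow_add hr.1]
  norm_num

theorem setIntegral_norm_rpow_ball {s : ℝ} (hs : 0 ≤ s) :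
    ∫ y in Metric.ball (0 : Space) s, ‖y‖ ^ (-(5 / 2) : ℝ) =
      6 * volume.real (Metric.ball (0 : Space) 1) * √s := by
  have h := integral_fun_norm_addHaar (volume : Measure Space)
    (Set.indicator (Set.Iio s) fun r => r ^ (-(5 / 2) : ℝ))
  have h1 : (fun x : Space => (Set.Iio s).indicator (fun r : ℝ => r ^ (-(5 / 2) : ℝ)) ‖x‖) =
      (Metric.ball (0 : Space) s).indicator fun y => ‖y‖ ^ (-(5 / 2) : ℝ) := by
    ext x
    simp [Set.indicator]
  rw [h1, integral_indicator Metric.isOpen_ball.measurableSet] at h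
  have h2 : ∫ y in Set.Ioi (0 : ℝ), y ^ (Module.finrank ℝ Space - 1) •
      (Set.Iio s).indicator (fun r : ℝ => r ^ (-(5 / 2) : ℝ)) y = 2 * √s := by
    calc _ = ∫ y in Set.Ioi (0 : ℝ), (Set.Iio s).indicator (fun r : ℝ => r ^ (-(1 / 2) : ℝ)) y := by
          refine setIntegral_congr_fun measurableSet_Ioi fun r hr => ?_
          by_cases hrs : r < s
          · simp only [finrank_euclideanSpace, Fintype.card_fin, smul_eq_mul, Set.indicator,
              Set.mem_Iio, hrs, if_true]
            rw [← Real.rpow_natCast, ← Real.rpow_add hr]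
            norm_num
          · simp [Set.indicator, hrs]
      _ = ∫ y in (0 : ℝ)..s, y ^ (-(1 / 2) : ℝ) := by
          rw [setIntegral_indicator measurableSet_Iio, intervalIntegral.integral_of_le hs,
            integral_Ioc_eq_integral_Ioo]
          rfl
      _ = 2 * √s := by
          rw [integral_rpow (Or.inl (by norm_num)), Real.sqrt_eq_rpow]
          norm_num
          ring
  rw [h, h2]
  simp only [finrank_euclideanSpace, Fintype.card_fin, smul_eq_mul, nsmul_eq_mul]
  push_cast
  ring

/-- The graph of `t ↦ t^(5/3)` lies strictly above its tangent at `c`, away from `c`. -/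
theorem rpow_tangent_lt {a c : ℝ} (ha : 0 ≤ a) (hc : 0 < c) (hac : a ≠ c) :
    c ^ (5 / 3 : ℝ) + 5 / 3 * c ^ (2 / 3 : ℝ) * (a - c) < a ^ (5 / 3 : ℝ) := by
  have h := one_add_mul_self_lt_rpow_one_add (s := a / c - 1) (p := 5 / 3)
    (by have := div_nonneg ha hc.le; linarith)
    (fun h => hac ((div_eq_one_iff_eq hc.ne').1 (by linarith))) (by norm_num)
  rw [add_sub_cancel, Real.div_rpow ha hc.le, lt_div_iff₀ (by positivity)] at h
  have e : c ^ (5 / 3 : ℝ) = c ^ (2 / 3 : ℝ) * c := by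
    rw [← Real.rpow_add_one hc.ne']; norm_num
  refine lt_of_eq_of_lt ?_ h
  rw [e]
  field_simp

theorem add_rpow_le {a b : ℝ} (ha : 0 ≤ a) (hb : 0 ≤ b) :
    (a + b) ^ (5 / 3 : ℝ) ≤ a ^ (5 / 3 : ℝ) + 5 / 3 * (a ^ (2 / 3 : ℝ) * b + b ^ (5 / 3 : ℝ)) := by
  rcases hb.eq_or_lt with rfl | hb
  · norm_num [Real.zero_rpow]
  have h := rpow_tangent_lt ha (show 0 < a + b by positivity) (by linarith)
  have h2 : (a + b) ^ (2 / 3 : ℝ) ≤ a ^ (2 / 3 : ℝ) + b ^ (2 / 3 : ℝ) :=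
    Real.rpow_add_le_add_rpow ha hb.le (by norm_num) (by norm_num)
  have e : b ^ (5 / 3 : ℝ) = b ^ (2 / 3 : ℝ) * b := by
    rw [← Real.rpow_add_one hb.ne']; norm_num
  rw [e]
  nlinarith [mul_le_mul_of_nonneg_right h2 hb.le]

/-- Dominates the Coulomb integrand: `5/3` and `5/2` are conjugate exponents, so for `‖z‖ < 1` one
of `a^(5/3)` and `‖z‖^(-5/2)` is at least `a / ‖z‖`. -/
theorem div_norm_le {a : ℝ} (ha : 0 ≤ a) (z : Space) :
    a / ‖z‖ ≤ a + a ^ (5 / 3 : ℝ) +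
      (Metric.ball (0 : Space) 1).indicator (fun y => ‖y‖ ^ (-(5 / 2) : ℝ)) z := by
  have hp : 0 ≤ a ^ (5 / 3 : ℝ) := by positivity
  rcases (norm_nonneg z).eq_or_lt with h0 | h0
  · rw [← h0, div_zero]
    refine add_nonneg (by positivity) (Set.indicator_nonneg (fun y _ => by positivity) _)
  by_cases h1 : ‖z‖ < 1
  · rw [Set.indicator_of_mem (by simpa using h1)]
    have hu : a / ‖z‖ = a * ‖z‖ ^ (-1 : ℝ) := by rw [Real.rpow_neg_one]; rfl
    have h2 : ‖z‖ ^ (-(5 / 2) : ℝ) = ‖z‖ ^ (-(3 / 2) : ℝ) * ‖z‖ ^ (-1 : ℝ) := by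
      rw [← Real.rpow_add h0]; norm_num
    have hq : 0 ≤ ‖z‖ ^ (-(5 / 2) : ℝ) := by positivity
    rcases le_total a (‖z‖ ^ (-(3 / 2) : ℝ)) with h | h
    · have := mul_le_mul_of_nonneg_right h (show 0 ≤ ‖z‖ ^ (-1 : ℝ) by positivity)
      rw [hu]; linarith
    · have ha' : 0 < a := lt_of_lt_of_le (by positivity) h
      have h3 : ‖z‖ ^ (-1 : ℝ) ≤ a ^ (2 / 3 : ℝ) := by
        have := Real.rpow_le_rpow (by positivity) h (show (0 : ℝ) ≤ 2 / 3 by norm_num)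
        rw [← Real.rpow_mul h0.le] at this
        convert this using 2; norm_num
      have e : a ^ (5 / 3 : ℝ) = a ^ (2 / 3 : ℝ) * a := by
        rw [← Real.rpow_add_one ha'.ne']; norm_num
      have := mul_le_mul_of_nonneg_left h3 ha
      rw [hu]; linarith
  · rw [Set.indicator_of_notMem (by simpa using h1), add_zero]
    have := div_le_self ha (not_lt.1 h1)
    linarith

/-! ### Admissible densities and absolute convergence -/

theorem Admissible.integrable {ρ : Space → ℝ} (hρ : Admissible ρ) : Integrable ρ :=
  memLp_one_iff_integrable.1 hρ.memLp_one

theorem Admissible.integrable_rpow {ρ : Space → ℝ} (hρ : Admissible ρ) :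
    Integrable (fun x => ρ x ^ (5 / 3 : ℝ)) := by
  have h := hρ.memLp_five_thirds.integrable_norm_rpow
    (ENNReal.div_pos (by norm_num) (by norm_num)).ne'
    (ENNReal.div_lt_top (by norm_num) (by norm_num)).ne
  refine h.congr ?_
  filter_upwards [hρ.nonneg] with x hx
  rw [Real.norm_of_nonneg hx, ENNReal.toReal_div]
  norm_num

theorem Admissible.of_le {ρ σ : Space → ℝ} (hρ : Admissible ρ) (hσm : AEStronglyMeasurable σ)
    (h0 : ∀ᵐ x, 0 ≤ σ x) (hle : ∀ᵐ x, σ x ≤ ρ x) : Admissible σ := by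
  have hn : ∀ᵐ x, ‖σ x‖ ≤ ‖ρ x‖ := by
    filter_upwards [h0, hle] with x h1 h2
    rw [Real.norm_of_nonneg h1, Real.norm_of_nonneg (h1.trans h2)]
    exact h2
  exact ⟨h0, hρ.memLp_one.mono hσm hn, hρ.memLp_five_thirds.mono hσm hn⟩

theorem integrable_kernel (x : Space) : Integrable fun y : Space =>
    (Metric.ball (0 : Space) 1).indicator (fun y => ‖y‖ ^ (-(5 / 2) : ℝ)) (x - y) :=
  ((integrableOn_norm_rpow_ball 1).integrable_indicator
    Metric.isOpen_ball.measurableSet).comp_sub_left x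

theorem Admissible.integrable_potential {ρ : Space → ℝ} (hρ : Admissible ρ) (x : Space) :
    Integrable fun y => ρ y / ‖x - y‖ := by
  refine ((hρ.integrable.add hρ.integrable_rpow).add (integrable_kernel x)).mono' ?_ ?_
  · exact (hρ.integrable.aemeasurable.div (by fun_prop)).aestronglyMeasurable
  · filter_upwards [hρ.nonneg] with y hy
    rw [Real.norm_of_nonneg (by positivity)]
    exact div_norm_le hy (x - y)

/-- The potential of an admissible density is bounded. -/
theorem Admissible.exists_potential_le {ρ : Space → ℝ} (hρ : Admissible ρ) :
    ∃ M, ∀ x, ∫ y, ρ y / ‖x - y‖ ≤ M := by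
  refine ⟨(∫ y, (ρ y + ρ y ^ (5 / 3 : ℝ))) + ∫ y,
    (Metric.ball (0 : Space) 1).indicator (fun y => ‖y‖ ^ (-(5 / 2) : ℝ)) y, fun x => ?_⟩
  rw [← integral_sub_left_eq_self ((Metric.ball (0 : Space) 1).indicator _) volume x]
  refine (integral_mono_ae (hρ.integrable_potential x)
    ((hρ.integrable.add hρ.integrable_rpow).add (integrable_kernel x)) ?_).trans_eq
    (integral_add (hρ.integrable.add hρ.integrable_rpow) (integrable_kernel x))
  filter_upwards [hρ.nonneg] with y hy using div_norm_le hy (x - y)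

theorem Admissible.integrable_coulomb {ρ σ : Space → ℝ} (hρ : Admissible ρ) (hσ : Admissible σ) :
    Integrable (fun p : Space × Space => ρ p.1 * σ p.2 / ‖p.1 - p.2‖) (volume.prod volume) := by
  have hm : AEStronglyMeasurable (fun p : Space × Space => ρ p.1 * σ p.2 / ‖p.1 - p.2‖)
      (volume.prod volume) := by
    refine (AEMeasurable.div ?_ (by fun_prop)).aestronglyMeasurable
    exact hρ.integrable.aemeasurable.comp_fst.mul hσ.integrable.aemeasurable.comp_snd
  refine (integrable_prod_iff hm).2 ⟨?_, ?_⟩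
  · refine .of_forall fun x => ?_
    simp only [mul_div_assoc]
    exact (hσ.integrable_potential x).const_mul _
  · obtain ⟨M, hM⟩ := hσ.exists_potential_le
    refine (hρ.integrable.norm.mul_const M).mono' hm.norm.integral_prod_right'
      (.of_forall fun x => ?_)
    rw [Real.norm_of_nonneg (integral_nonneg fun _ => norm_nonneg _)]
    have e : ∀ᵐ y, ‖ρ x * σ y / ‖x - y‖‖ = ‖ρ x‖ * (σ y / ‖x - y‖) := by
      filter_upwards [hσ.nonneg] with y hy
      rw [mul_div_assoc, norm_mul, Real.norm_of_nonneg (show 0 ≤ σ y / ‖x - y‖ by positivity)]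
    rw [integral_congr_ae e, integral_const_mul]
    exact mul_le_mul_of_nonneg_left (hM x) (norm_nonneg _)

/-! ### The Coulomb form on admissible densities -/

theorem Admissible.coulomb_eq {ρ σ : Space → ℝ} (hρ : Admissible ρ) (hσ : Admissible σ) :
    coulomb ρ σ =
      (1 / 2) * ∫ p : Space × Space, ρ p.1 * σ p.2 / ‖p.1 - p.2‖ ∂(volume.prod volume) := by
  rw [integral_prod _ (hρ.integrable_coulomb hσ)]
  rfl

theorem Admissible.coulomb_mono {ρ σ : Space → ℝ} (hρ : Admissible ρ) (hσ : Admissible σ)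
    (hle : ∀ᵐ x, σ x ≤ ρ x) : coulomb σ σ ≤ coulomb ρ ρ := by
  rw [hρ.coulomb_eq hρ, hσ.coulomb_eq hσ]
  refine mul_le_mul_of_nonneg_left ?_ (by norm_num)
  refine integral_mono_ae (hσ.integrable_coulomb hσ) (hρ.integrable_coulomb hρ) ?_
  have h := hle.and hσ.nonneg
  filter_upwards [Measure.quasiMeasurePreserving_fst.ae h, Measure.quasiMeasurePreserving_snd.ae h]
    with p h1 h2
  have := mul_le_mul h1.1 h2.1 h2.2 (h1.2.trans h1.1)
  gcongr

theorem Admissible.coulomb_comm {ρ σ : Space → ℝ} (hρ : Admissible ρ) (hσ : Admissible σ) :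
    coulomb ρ σ = coulomb σ ρ := by
  rw [hρ.coulomb_eq hσ, hσ.coulomb_eq hρ, ← integral_prod_swap]
  simp only [Prod.fst_swap, Prod.snd_swap, mul_comm (ρ _), norm_sub_rev]

theorem Admissible.add_const_mul {ρ φ : Space → ℝ} (hρ : Admissible ρ) (hφ : Admissible φ)
    {ε : ℝ} (hε : 0 ≤ ε) : Admissible fun x => ρ x + ε * φ x := by
  refine ⟨?_, hρ.memLp_one.add (hφ.memLp_one.const_mul ε),
    hρ.memLp_five_thirds.add (hφ.memLp_five_thirds.const_mul ε)⟩
  filter_upwards [hρ.nonneg, hφ.nonneg] with x h1 h2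
  positivity

theorem Admissible.coulomb_add_const_mul {ρ φ : Space → ℝ} (hρ : Admissible ρ)
    (hφ : Admissible φ) {ε : ℝ} (hε : 0 ≤ ε) :
    coulomb (fun x => ρ x + ε * φ x) (fun x => ρ x + ε * φ x) =
      coulomb ρ ρ + ε * (2 * coulomb ρ φ) + ε ^ 2 * coulomb φ φ := by
  have h := hρ.add_const_mul hφ hε
  have e : (fun p : Space × Space =>
      (ρ p.1 + ε * φ p.1) * (ρ p.2 + ε * φ p.2) / ‖p.1 - p.2‖) = fun p =>
      (ρ p.1 * ρ p.2 / ‖p.1 - p.2‖ + ε * (ρ p.1 * φ p.2 / ‖p.1 - p.2‖)) +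
      (ε * (φ p.1 * ρ p.2 / ‖p.1 - p.2‖) + ε ^ 2 * (φ p.1 * φ p.2 / ‖p.1 - p.2‖)) := by
    ext p; ring
  have i1 := hρ.integrable_coulomb hρ
  have i2 := (hρ.integrable_coulomb hφ).const_mul ε
  have i3 := (hφ.integrable_coulomb hρ).const_mul ε
  have i4 := (hφ.integrable_coulomb hφ).const_mul (ε ^ 2)
  rw [two_mul]
  nth_rw 2 [hρ.coulomb_comm hφ]
  have hsum := (integral_add (i1.add i2) (i3.add i4)).trans
    (congrArg₂ (· + ·) (integral_add i1 i2) (integral_add i3 i4))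
  simp only [Pi.add_apply] at hsum
  rw [h.coulomb_eq h, e, hsum, hρ.coulomb_eq hρ, hρ.coulomb_eq hφ, hφ.coulomb_eq hρ,
    hφ.coulomb_eq hφ]
  simp only [integral_const_mul]
  ring

/-! ### The pointwise upper bound on the minimizer -/

theorem Admissible.integrable_local {ρ : Space → ℝ} (hρ : Admissible ρ) (Z : ℝ) :
    Integrable fun x => (3 / 5) * gammaTF * ρ x ^ (5 / 3 : ℝ) - Z / ‖x‖ * ρ x := by
  refine (hρ.integrable_rpow.const_mul _).sub ?_
  have h := (hρ.integrable_potential 0).const_mul Z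
  refine h.congr (.of_forall fun x => ?_)
  simp only [zero_sub, norm_neg]
  ring

/-- The local energy `(3/5) γ t^(5/3) - V t` at any `t = a` above its critical point `c` exceeds its
value at `c`. -/
theorem local_energy_lt {γ V a c : ℝ} (hγ : 0 < γ) (hc : 0 < c) (hV : γ * c ^ (2 / 3 : ℝ) = V)
    (hca : c < a) :
    (3 / 5) * γ * c ^ (5 / 3 : ℝ) - V * c < (3 / 5) * γ * a ^ (5 / 3 : ℝ) - V * a := by
  have h := mul_lt_mul_of_pos_left (rpow_tangent_lt (hc.trans hca).le hc hca.ne')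
    (show 0 < 3 / 5 * γ by positivity)
  have e : 3 / 5 * γ * (c ^ (5 / 3 : ℝ) + 5 / 3 * c ^ (2 / 3 : ℝ) * (a - c)) =
      (3 / 5) * γ * c ^ (5 / 3 : ℝ) + V * (a - c) := by
    rw [← hV]; ring
  linarith

/-- The Thomas-Fermi density lies below the density in the bare nuclear potential, since otherwise
cutting it off there would lower the energy. -/
theorem IsTFDensity.ae_le {Z : ℝ} (hZ : 0 < Z) {ρ : Space → ℝ} (h : IsTFDensity Z ρ) :
    ∀ᵐ x, ρ x ≤ (Z / (gammaTF * ‖x‖)) ^ (3 / 2 : ℝ) := by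
  obtain ⟨hρ, hmin⟩ := h
  have hγ := gammaTF_pos
  set c : Space → ℝ := fun x => (Z / (gammaTF * ‖x‖)) ^ (3 / 2 : ℝ) with hcdef
  have hσ : Admissible fun x => min (ρ x) (c x) := by
    refine hρ.of_le ?_ ?_ (.of_forall fun x => min_le_left _ _)
    · have hc : Measurable c := by fun_prop
      exact (hρ.integrable.aemeasurable.min hc.aemeasurable).aestronglyMeasurable
    · filter_upwards [hρ.nonneg] with x hx using le_min hx (by positivity)
  have hlt : ∀ᵐ x : Space, c x < ρ x →
      (3 / 5) * gammaTF * c x ^ (5 / 3 : ℝ) - Z / ‖x‖ * c x <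
        (3 / 5) * gammaTF * ρ x ^ (5 / 3 : ℝ) - Z / ‖x‖ * ρ x := by
    filter_upwards [Measure.ae_ne volume (0 : Space)] with x hx hxc
    have hx' : 0 < ‖x‖ := norm_pos_iff.2 hx
    refine local_energy_lt hγ (by positivity) ?_ hxc
    rw [hcdef, ← Real.rpow_mul (by positivity)]
    norm_num
    field_simp
  have hle : ∀ᵐ x : Space,
      0 ≤ ((3 / 5) * gammaTF * ρ x ^ (5 / 3 : ℝ) - Z / ‖x‖ * ρ x) -
        ((3 / 5) * gammaTF * min (ρ x) (c x) ^ (5 / 3 : ℝ) - Z / ‖x‖ * min (ρ x) (c x)) := by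
    filter_upwards [hlt] with x hx
    rcases le_or_gt (ρ x) (c x) with h1 | h1
    · rw [min_eq_left h1, sub_self]
    · rw [min_eq_right h1.le]
      exact sub_nonneg.2 (hx h1).le
  have i1 := hρ.integrable_local Z
  have i2 := hσ.integrable_local Z
  have hE := hmin _ hσ
  have hD := hρ.coulomb_mono hσ (.of_forall fun x => min_le_left _ _)
  unfold energy at hE
  have h0 := integral_nonneg_of_ae hle
  have h1 := integral_sub i1 i2
  have h2 := (integral_eq_zero_iff_of_nonneg_ae hle (i1.sub i2)).1 (by linarith)
  -- The local energies of `ρ` and of its truncation agree almost everywhere, so nothing is cut off.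
  filter_upwards [h2, hlt] with x h3 h4
  by_contra! h5
  rw [min_eq_right h5.le, Pi.zero_apply] at h3
  linarith [h4 h5]

/-! ### The charge of the minimizer is at least `Z` -/

theorem admissible_indicator_ball (R : ℝ) :
    Admissible ((Metric.ball (0 : Space) R).indicator fun _ => (1 : ℝ)) :=
  ⟨.of_forall fun _ => Set.indicator_nonneg (fun _ _ => zero_le_one) _,
    memLp_indicator_const _ Metric.isOpen_ball.measurableSet _ (.inr measure_ball_lt_top.ne),
    memLp_indicator_const _ Metric.isOpen_ball.measurableSet _ (.inr measure_ball_lt_top.ne)⟩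

/-- The potential of a uniformly charged ball is largest at its center. This is the bathtub
principle: among translates of the ball, the one about the origin captures the set where `1/‖z‖`
exceeds `1/R`. -/
theorem potential_indicator_ball_le {R : ℝ} (hR : 0 < R) (x : Space) :
    ∫ y, (Metric.ball (0 : Space) R).indicator (fun _ => (1 : ℝ)) y / ‖x - y‖ ≤
      ∫ y, (Metric.ball (0 : Space) R).indicator (fun _ => (1 : ℝ)) y / ‖y‖ := by
  set φ : Space → ℝ := (Metric.ball (0 : Space) R).indicator fun _ => (1 : ℝ) with hφdef
  have hφ : Admissible φ := admissible_indicator_ball R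
  have i1 : Integrable fun z => φ (x - z) / ‖z‖ := by
    have := (hφ.integrable_potential x).comp_sub_left x
    simpa using this
  have i2 : Integrable fun z => φ z / ‖z‖ := by simpa using hφ.integrable_potential 0
  have i3 : Integrable fun z => (φ (x - z) - φ z) / R :=
    ((hφ.integrable.comp_sub_left x).sub hφ.integrable).div_const R
  -- The substitution `z = x - y` fixes the singularity and moves the ball instead.
  have e1 : ∫ y, φ y / ‖x - y‖ = ∫ z, φ (x - z) / ‖z‖ := by
    rw [← integral_sub_left_eq_self _ volume x]
    simp
  have e2 : ∫ z, (φ (x - z) - φ z) / R = 0 := by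
    rw [integral_div, integral_sub (hφ.integrable.comp_sub_left x) hφ.integrable,
      integral_sub_left_eq_self φ volume x, sub_self, zero_div]
  calc ∫ y, φ y / ‖x - y‖ = ∫ z, φ (x - z) / ‖z‖ := e1
    _ ≤ ∫ z, (φ z / ‖z‖ + (φ (x - z) - φ z) / R) := by
        refine integral_mono_ae i1 (i2.add i3) ?_
        filter_upwards [Measure.ae_ne volume (0 : Space)] with z hz
        have hz' : 0 < ‖z‖ := norm_pos_iff.2 hz
        have h0 : 0 ≤ φ (x - z) := Set.indicator_nonneg (fun _ _ => zero_le_one) _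
        have h1 : φ (x - z) ≤ 1 := Set.indicator_le_self' (fun _ _ => zero_le_one) _
        by_cases hzR : ‖z‖ < R
        · have hφz : φ z = 1 := Set.indicator_of_mem (by simpa using hzR) _
          have h2 := mul_le_mul_of_nonneg_left (one_div_le_one_div_of_le hz' hzR.le)
            (sub_nonneg.2 h1)
          have e : φ z / ‖z‖ + (φ (x - z) - φ z) / R - φ (x - z) / ‖z‖ =
              (1 - φ (x - z)) * (1 / ‖z‖) - (1 - φ (x - z)) * (1 / R) := by
            rw [hφz]; ring
          linarith
        · have hφz : φ z = 0 := Set.indicator_of_notMem (by simpa using hzR) _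
          rw [hφz, zero_div, zero_add, sub_zero]
          exact div_le_div_of_nonneg_left h0 hR (not_lt.1 hzR)
    _ = ∫ z, φ z / ‖z‖ := by rw [integral_add i2 i3, e2, add_zero]

/-- The scale `(R³)⁻¹` at which the two terms balance makes the kinetic term of a ball of radius `R`
of order `R`, while the electrostatic terms are of order `R²`. -/
theorem rpow_two_thirds_le {a R : ℝ} (ha : 0 ≤ a) (hR : 0 < R) :
    a ^ (2 / 3 : ℝ) ≤ R * a + (R ^ 2)⁻¹ := by
  rcases le_total a ((R ^ 3)⁻¹) with h | h
  · have h1 := Real.rpow_le_rpow ha h (show (0 : ℝ) ≤ 2 / 3 by norm_num)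
    have e : ((R ^ 3)⁻¹) ^ (2 / 3 : ℝ) = (R ^ 2)⁻¹ := by
      rw [Real.inv_rpow (by positivity), ← Real.rpow_natCast, ← Real.rpow_mul hR.le,
        ← Real.rpow_natCast]
      norm_num
    rw [e] at h1
    have : 0 ≤ R * a := by positivity
    linarith
  · have ha' : 0 < a := lt_of_lt_of_le (by positivity) h
    have h1 : R⁻¹ ≤ a ^ (1 / 3 : ℝ) := by
      have h1 := Real.rpow_le_rpow (by positivity) h (show (0 : ℝ) ≤ 1 / 3 by norm_num)
      have e : ((R ^ 3)⁻¹) ^ (1 / 3 : ℝ) = R⁻¹ := by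
        rw [Real.inv_rpow (by positivity), ← Real.rpow_natCast, ← Real.rpow_mul hR.le]
        norm_num
      rwa [e] at h1
    have h2 : 1 ≤ R * a ^ (1 / 3 : ℝ) := by
      have := mul_le_mul_of_nonneg_left h1 hR.le
      rwa [mul_inv_cancel₀ hR.ne'] at this
    have e2 : R * a = R * a ^ (1 / 3 : ℝ) * a ^ (2 / 3 : ℝ) := by
      rw [mul_assoc, ← Real.rpow_add ha']; norm_num
    have h3 := mul_le_mul_of_nonneg_right h2 (show 0 ≤ a ^ (2 / 3 : ℝ) by positivity)
    have : 0 ≤ (R ^ 2)⁻¹ := by positivity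
    linarith

/-- If a perturbation with linear coefficient `a` never lowers the energy, then `0 ≤ a`; the
exponents `5/3` and `2` are those of the kinetic and Coulomb energies of the perturbation. -/
theorem nonneg_of_forall_pos {a b c : ℝ}
    (h : ∀ ε : ℝ, 0 < ε → 0 ≤ ε * a + ε ^ (5 / 3 : ℝ) * b + ε ^ 2 * c) : 0 ≤ a := by
  have hc : ContinuousAt (fun ε : ℝ => a + ε ^ (2 / 3 : ℝ) * b + ε * c) 0 :=
    ((continuousAt_const.add ((Real.continuousAt_rpow_const _ _ (.inr (by norm_num))).mul
      continuousAt_const)).add (continuousAt_id.mul continuousAt_const))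
  have ht := hc.tendsto.mono_left (nhdsWithin_le_nhds (s := Set.Ioi (0 : ℝ)))
  have e : a + (0 : ℝ) ^ (2 / 3 : ℝ) * b + 0 * c = a := by
    rw [Real.zero_rpow (by norm_num)]; ring
  rw [e] at ht
  refine ge_of_tendsto ht ?_
  filter_upwards [self_mem_nhdsWithin] with ε hε
  have hε : 0 < ε := hε
  have h1 := h ε hε
  have e : ε ^ (5 / 3 : ℝ) = ε ^ (2 / 3 : ℝ) * ε := by
    rw [← Real.rpow_add_one hε.ne']; norm_num
  rw [e] at h1
  refine le_of_mul_le_mul_left ?_ hε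
  linarith

/-- The first variation of the energy in the direction of the indicator of the ball of radius `R`,
after estimating its kinetic term by `rpow_two_thirds_le` and its repulsion by
`potential_indicator_ball_le`. -/
theorem IsTFDensity.first_variation_ball {Z : ℝ} {ρ : Space → ℝ} (h : IsTFDensity Z ρ) {R : ℝ}
    (hR : 0 < R) :
    0 ≤ gammaTF * R * (∫ x, ρ x) + gammaTF * (R ^ 2)⁻¹ * volume.real (Metric.ball (0 : Space) R) +
      ((∫ x, ρ x) - Z) *
        ∫ y, (Metric.ball (0 : Space) R).indicator (fun _ => (1 : ℝ)) y / ‖y‖ := by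
  obtain ⟨hρ, hmin⟩ := h
  have hγ := gammaTF_pos
  set φ : Space → ℝ := (Metric.ball (0 : Space) R).indicator fun _ => (1 : ℝ) with hφdef
  have hφ : Admissible φ := admissible_indicator_ball R
  have hφ01 : ∀ x, φ x = 0 ∨ φ x = 1 := fun x => by
    by_cases hx : x ∈ Metric.ball (0 : Space) R
    · exact .inr (Set.indicator_of_mem hx _)
    · exact .inl (Set.indicator_of_notMem hx _)
  have iφ : Integrable fun z => φ z / ‖z‖ := by simpa using hφ.integrable_potential 0
  have hm : ∫ x, φ x = volume.real (Metric.ball (0 : Space) R) :=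
    integral_indicator_one Metric.isOpen_ball.measurableSet
  set W := ∫ y, φ y / ‖y‖ with hW
  have hD : 2 * coulomb ρ φ ≤ (∫ x, ρ x) * W := by
    have e : 2 * coulomb ρ φ = ∫ x, ∫ y, ρ x * φ y / ‖x - y‖ := by
      unfold coulomb; ring
    rw [e, ← integral_mul_const]
    refine integral_mono_ae (hρ.integrable_coulomb hφ).integral_prod_left
      (hρ.integrable.mul_const W) ?_
    filter_upwards [hρ.nonneg] with x hx
    simp only [mul_div_assoc]
    rw [integral_const_mul]
    exact mul_le_mul_of_nonneg_left (potential_indicator_ball_le hR x) hx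
  suffices h0 : 0 ≤ gammaTF * R * (∫ x, ρ x) + gammaTF * (R ^ 2)⁻¹ * (∫ x, φ x) +
      (2 * coulomb ρ φ - Z * W) by
    rw [← hm]; linarith
  -- Compare `ρ` with `ρ + ε φ` and let `ε` tend to `0`.
  refine nonneg_of_forall_pos (b := gammaTF * ∫ x, φ x) (c := coulomb φ φ) fun ε hε => ?_
  have hσ := hρ.add_const_mul hφ hε.le
  have hE := hmin _ hσ
  unfold energy at hE
  rw [hρ.coulomb_add_const_mul hφ hε.le] at hE
  have i1 := hρ.integrable_local Z
  have i2 := hρ.integrable.const_mul (ε * gammaTF * R)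
  have i3 := hφ.integrable.const_mul (ε * gammaTF * (R ^ 2)⁻¹ + ε ^ (5 / 3 : ℝ) * gammaTF)
  have i4 := iφ.const_mul (ε * Z)
  have hloc : ∫ x, ((3 / 5) * gammaTF * (ρ x + ε * φ x) ^ (5 / 3 : ℝ) -
        Z / ‖x‖ * (ρ x + ε * φ x)) ≤
      ∫ x, (((3 / 5) * gammaTF * ρ x ^ (5 / 3 : ℝ) - Z / ‖x‖ * ρ x) + ε * gammaTF * R * ρ x +
        (ε * gammaTF * (R ^ 2)⁻¹ + ε ^ (5 / 3 : ℝ) * gammaTF) * φ x - ε * Z * (φ x / ‖x‖)) := by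
    refine integral_mono_ae (hσ.integrable_local Z) (((i1.add i2).add i3).sub i4) ?_
    filter_upwards [hρ.nonneg] with x hx
    have hp : 0 ≤ ε * gammaTF * R * ρ x := by positivity
    rcases hφ01 x with h1 | h1
    · simp only [h1]
      simp only [mul_zero, add_zero, zero_div, sub_zero]
      linarith
    · simp only [h1, mul_one]
      have h2 := mul_le_mul_of_nonneg_left (add_rpow_le hx hε.le)
        (show 0 ≤ 3 / 5 * gammaTF by positivity)
      have h3 := mul_le_mul_of_nonneg_left (rpow_two_thirds_le hx hR)
        (show 0 ≤ gammaTF * ε by positivity)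
      have e : Z / ‖x‖ * (ρ x + ε) = Z / ‖x‖ * ρ x + ε * Z * (1 / ‖x‖) := by ring
      rw [e]
      linarith
  have hsum := integral_sub ((i1.add i2).add i3) i4
  rw [integral_add' (i1.add i2) i3, integral_add' i1 i2] at hsum
  simp only [Pi.add_apply] at hsum
  rw [hsum] at hloc
  simp only [integral_const_mul] at hloc
  linarith

theorem IsTFDensity.le_charge {Z : ℝ} {ρ : Space → ℝ} (h : IsTFDensity Z ρ) :
    Z ≤ ∫ x, ρ x := by
  by_contra! hlt
  have hγ := gammaTF_pos
  set N := ∫ x, ρ x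
  set v := volume.real (Metric.ball (0 : Space) 1)
  have hv : 0 < v :=
    ENNReal.toReal_pos (Metric.measure_ball_pos _ _ one_pos).ne' measure_ball_lt_top.ne
  have hN : 0 ≤ N := integral_nonneg_of_ae h.1.nonneg
  have key : ∀ R : ℝ, 0 < R → (Z - N) * v * R ≤ gammaTF * (N + v) := by
    intro R hR
    have h1 := h.first_variation_ball hR
    have hvol : volume.real (Metric.ball (0 : Space) R) = R ^ 3 * v := by
      simp only [v, Measure.real]
      rw [Measure.addHaar_ball _ _ hR.le, ENNReal.toReal_mul, ENNReal.toReal_ofReal (by positivity)]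
      simp
    have hφ := admissible_indicator_ball R
    have hW : R ^ 2 * v ≤
        ∫ y, (Metric.ball (0 : Space) R).indicator (fun _ => (1 : ℝ)) y / ‖y‖ := by
      have e : R ^ 2 * v = ∫ y, (Metric.ball (0 : Space) R).indicator (fun _ => (1 : ℝ)) y / R := by
        rw [integral_div, show (∫ y, (Metric.ball (0 : Space) R).indicator (fun _ => (1 : ℝ)) y) =
          _ from integral_indicator_one Metric.isOpen_ball.measurableSet, hvol]
        field_simp
      rw [e]
      refine integral_mono_ae (hφ.integrable.div_const R)
        (by simpa using hφ.integrable_potential 0) ?_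
      filter_upwards [Measure.ae_ne volume (0 : Space)] with y hy
      by_cases hyR : y ∈ Metric.ball (0 : Space) R
      · simp only [Set.indicator_of_mem hyR]
        exact one_div_le_one_div_of_le (norm_pos_iff.2 hy) (mem_ball_zero_iff.1 hyR).le
      · simp [Set.indicator_of_notMem hyR]
    have h2 := mul_le_mul_of_nonneg_left hW (sub_nonneg.2 hlt.le)
    rw [hvol] at h1
    have e : gammaTF * (R ^ 2)⁻¹ * (R ^ 3 * v) = gammaTF * R * v := by field_simp
    rw [e] at h1
    refine le_of_mul_le_mul_right ?_ hR
    nlinarith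
  have hpos : 0 < (Z - N) * v := mul_pos (sub_pos.2 hlt) hv
  have hB : 0 < gammaTF * (N + v) + 1 := by positivity
  -- The left side of `key` is linear in `R`; at this radius it exceeds the right side.
  have h3 := key ((gammaTF * (N + v) + 1) / ((Z - N) * v)) (by positivity)
  rw [mul_div_cancel₀ _ hpos.ne'] at h3
  linarith

/-! ### The radius of the exchange hole -/

theorem continuous_integral_ball {ρ : Space → ℝ} (hρ : Integrable ρ) (x : Space) :
    Continuous fun R : ℝ => ∫ y in Metric.ball x R, ρ y := by
  have e : (fun R : ℝ => ∫ y in Metric.ball x R, ρ y) =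
      fun R => ∫ y, (Metric.ball x R).indicator ρ y := by
    ext R; rw [integral_indicator Metric.isOpen_ball.measurableSet]
  rw [e, continuous_iff_continuousAt]
  intro R
  refine continuousAt_of_dominated (bound := fun y => ‖ρ y‖)
    (.of_forall fun R => (hρ.indicator Metric.isOpen_ball.measurableSet).aestronglyMeasurable)
    (.of_forall fun R => .of_forall fun y => norm_indicator_le_norm_self _ _) hρ.norm ?_
  have hs : ∀ᵐ y : Space, y ∉ Metric.sphere x R :=
    measure_eq_zero_iff_ae_notMem.1 (Measure.addHaar_sphere volume x R)
  filter_upwards [hs] with y hy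
  rcases lt_or_gt_of_ne hy with h | h
  · refine (continuousAt_const (y := ρ y)).congr ?_
    filter_upwards [lt_mem_nhds h] with r hr
    exact (Set.indicator_of_mem (by simpa using hr) _).symm
  · refine (continuousAt_const (y := (0 : ℝ))).congr ?_
    filter_upwards [gt_mem_nhds h] with r hr
    exact (Set.indicator_of_notMem (by simpa using hr.le) _).symm

theorem isLeast_holeRadius {ρ : Space → ℝ} (hρ : Integrable ρ) (hN : 1 / 2 < ∫ x, ρ x)
    (x : Space) : IsLeast (halfChargeRadii ρ x) (holeRadius ρ x) := by
  have hc := continuous_integral_ball hρ x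
  refine IsClosed.isLeast_csInf ?_ ?_ ⟨0, fun R hR => hR.1⟩
  · exact (isClosed_le continuous_const continuous_id).inter (isClosed_eq hc continuous_const)
  · have ht : Filter.Tendsto (fun n : ℕ => ∫ y in Metric.ball x n, ρ y) Filter.atTop
        (nhds (∫ y, ρ y)) := by
      have := tendsto_setIntegral_of_monotone (μ := volume) (f := ρ)
        (s := fun n : ℕ => Metric.ball x n) (fun n => Metric.isOpen_ball.measurableSet)
        (fun m n hmn => Metric.ball_subset_ball (by exact_mod_cast hmn)) hρ.integrableOn
      simpa [Metric.iUnion_ball_nat] using this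
    obtain ⟨n, hn⟩ := (ht.eventually (lt_mem_nhds hN)).exists
    obtain ⟨R, hR, hR'⟩ := intermediate_value_Icc (Nat.cast_nonneg (α := ℝ) n) hc.continuousOn
      (show (1 / 2 : ℝ) ∈ Set.Icc _ _ from ⟨by simp, hn.le⟩)
    exact ⟨R, hR.1, hR'⟩

/-! ### The potential of the exchange hole -/

/-- Replacing the larger of the two distances by the smaller one bounds the left-hand side by a
sum of two translates of one kernel, whose integral over `y` does not depend on `x`. -/
theorem rpow_mul_inv_le {x y : Space} {s : ℝ} (hxy : x ≠ y) (hy : y ≠ 0) (hs : ‖x - y‖ < s) :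
    ‖y‖ ^ (-(3 / 2) : ℝ) * ‖x - y‖⁻¹ ≤
      (Metric.ball (0 : Space) s).indicator (fun z => ‖z‖ ^ (-(5 / 2) : ℝ)) (x - y) +
        (Metric.ball (0 : Space) s).indicator (fun z => ‖z‖ ^ (-(5 / 2) : ℝ)) y := by
  have h1 : 0 < ‖x - y‖ := norm_pos_iff.2 (sub_ne_zero.2 hxy)
  have h2 : 0 < ‖y‖ := norm_pos_iff.2 hy
  have e : ∀ r : ℝ, 0 < r → r ^ (-(5 / 2) : ℝ) = r ^ (-(3 / 2) : ℝ) * r⁻¹ := fun r hr => by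
    rw [← Real.rpow_neg_one r, ← Real.rpow_add hr]; norm_num
  have hnn : ∀ z, 0 ≤ (Metric.ball (0 : Space) s).indicator (fun z => ‖z‖ ^ (-(5 / 2) : ℝ)) z :=
    fun z => Set.indicator_nonneg (fun z _ => by positivity) _
  rcases le_or_gt ‖x - y‖ ‖y‖ with h | h
  · refine le_add_of_le_of_nonneg ?_ (hnn y)
    rw [Set.indicator_of_mem (by simpa using hs), e _ h1]
    exact mul_le_mul_of_nonneg_right (Real.rpow_le_rpow_of_nonpos h1 h (by norm_num))
      (by positivity)
  · refine le_add_of_nonneg_of_le (hnn _) ?_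
    rw [Set.indicator_of_mem (by simpa using h.trans hs), e _ h2]
    exact mul_le_mul_of_nonneg_left (inv_anti₀ h2 h.le) (by positivity)

theorem IsTFDensity.abs_holePotential_le {Z : ℝ} (hZ : 0 < Z) {ρ : Space → ℝ}
    (h : IsTFDensity Z ρ) {x : Space} (hx : holeRadius ρ x ∈ halfChargeRadii ρ x) :
    |holePotential ρ x| ≤
      (1 / 2 + 12 * gammaTF ^ (-(3 / 2) : ℝ) * volume.real (Metric.ball (0 : Space) 1)) * Z := by
  have hρ := h.1
  have hγ := gammaTF_pos
  set k : Space → ℝ :=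
    (Metric.ball (0 : Space) Z⁻¹).indicator (fun z => ‖z‖ ^ (-(5 / 2) : ℝ)) with hk
  have hknn : ∀ z, 0 ≤ k z := fun z => Set.indicator_nonneg (fun z _ => by positivity) _
  have ik : Integrable k :=
    (integrableOn_norm_rpow_ball _).integrable_indicator Metric.isOpen_ball.measurableSet
  have hkint : ∫ z, k z = 6 * volume.real (Metric.ball (0 : Space) 1) * √Z⁻¹ := by
    rw [hk, integral_indicator Metric.isOpen_ball.measurableSet,
      setIntegral_norm_rpow_ball (by positivity)]
  set K := (Z / gammaTF) ^ (3 / 2 : ℝ) with hK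
  have hKnn : 0 ≤ K := by positivity
  have ikk : Integrable fun y => K * (k (x - y) + k y) :=
    ((ik.comp_sub_left x).add ik).const_mul K
  have hpt : ∀ᵐ y, ρ y / ‖x - y‖ ≤ Z * ρ y + K * (k (x - y) + k y) := by
    filter_upwards [h.ae_le hZ, hρ.nonneg, Measure.ae_ne volume (0 : Space),
      Measure.ae_ne volume x] with y h1 h2 hy hyx
    have hy' : 0 < ‖y‖ := norm_pos_iff.2 hy
    have hxy : 0 < ‖x - y‖ := norm_pos_iff.2 (sub_ne_zero.2 hyx.symm)
    -- `1/Z` is the natural size of an exchange hole at the nucleus, where the density is of order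
    -- `(Z/|y|)^(3/2)`.
    by_cases hs : ‖x - y‖ < Z⁻¹
    · have h3 := mul_le_mul_of_nonneg_left (rpow_mul_inv_le hyx.symm hy hs) hKnn
      have e : (Z / (gammaTF * ‖y‖)) ^ (3 / 2 : ℝ) = K * ‖y‖ ^ (-(3 / 2) : ℝ) := by
        rw [← div_div, Real.div_rpow (by positivity) hy'.le, Real.rpow_neg hy'.le]
        rfl
      rw [e] at h1
      have h4 := mul_le_mul_of_nonneg_right h1 (inv_nonneg.2 hxy.le)
      have : 0 ≤ Z * ρ y := by positivity
      rw [div_eq_mul_inv]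
      linarith
    · have h3 : ‖x - y‖⁻¹ ≤ Z := inv_le_of_inv_le₀ hZ (not_lt.1 hs)
      have h4 := mul_le_mul_of_nonneg_left h3 h2
      have : 0 ≤ K * (k (x - y) + k y) :=
        mul_nonneg hKnn (add_nonneg (hknn _) (hknn _))
      rw [div_eq_mul_inv]
      linarith
  have hnn : 0 ≤ holePotential ρ x := by
    refine integral_nonneg_of_ae (ae_restrict_of_ae ?_)
    filter_upwards [hρ.nonneg] with y hy using div_nonneg hy (norm_nonneg _)
  rw [abs_of_nonneg hnn]
  calc holePotential ρ x
      ≤ ∫ y in Metric.ball x (holeRadius ρ x), (Z * ρ y + K * (k (x - y) + k y)) :=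
        integral_mono_ae (hρ.integrable_potential x).integrableOn
          ((hρ.integrable.const_mul Z).add ikk).integrableOn (ae_restrict_of_ae hpt)
    _ = Z * (1 / 2) + ∫ y in Metric.ball x (holeRadius ρ x), K * (k (x - y) + k y) := by
        rw [integral_add (hρ.integrable.const_mul Z).integrableOn ikk.integrableOn,
          integral_const_mul, hx.2]
    _ ≤ Z * (1 / 2) + ∫ y, K * (k (x - y) + k y) := by
        refine add_le_add_right (setIntegral_le_integral ikk (.of_forall fun y => ?_)) _
        exact mul_nonneg hKnn (add_nonneg (hknn _) (hknn _))
    _ = Z * (1 / 2) + K * (12 * volume.real (Metric.ball (0 : Space) 1) * √Z⁻¹) := by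
        rw [integral_const_mul, integral_add (ik.comp_sub_left x) ik,
          integral_sub_left_eq_self k volume x, hkint]
        ring
    _ = _ := by
        have e : K * √Z⁻¹ = gammaTF ^ (-(3 / 2) : ℝ) * Z := by
          rw [hK, Real.div_rpow hZ.le hγ.le, Real.sqrt_eq_rpow, ← Real.rpow_neg_one Z,
            ← Real.rpow_mul hZ.le, Real.rpow_neg hγ.le, div_mul_eq_mul_div, ← Real.rpow_add hZ]
          norm_num
          ring
        linear_combination (12 * volume.real (Metric.ball (0 : Space) 1)) * e

end ThomasFermi

theorem lemma4 :
    ∃ C : ℝ, ∀ Z : ℝ, 1 / 2 < Z → ∀ ρ : ThomasFermi.Space → ℝ, ThomasFermi.IsTFDensity Z ρ →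
      ∀ x : ThomasFermi.Space,
        IsLeast (ThomasFermi.halfChargeRadii ρ x) (ThomasFermi.holeRadius ρ x) ∧
        IntegrableOn (fun y : ThomasFermi.Space => ρ y / ‖x - y‖)
          (Metric.ball x (ThomasFermi.holeRadius ρ x)) volume ∧
        |ThomasFermi.holePotential ρ x| ≤ C * Z := by
  refine ⟨1 / 2 + 12 * ThomasFermi.gammaTF ^ (-(3 / 2) : ℝ) *
    volume.real (Metric.ball (0 : ThomasFermi.Space) 1), fun Z hZ ρ h x => ?_⟩
  have hR := ThomasFermi.isLeast_holeRadius h.1.integrable (hZ.trans_le h.le_charge) x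
  exact ⟨hR, (h.1.integrable_potential x).integrableOn,
    h.abs_holePotential_le (by linarith) hR.1⟩
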